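/- Let $M$ be a matroid of rank $k$ with rank function $\operatorname{rk}$ on the ground set $E=\{1,\dots,n\}$. For $A\subseteq E$ let $e_A=\sum_{i\in A}e_i\in\mathbb{R}^n$, and let \[ \mathscr{P}_I(M)=\operatorname{conv}\{e_I : I\subseteq E \text{ independent}\}\subseteq\mathbb{R}^n,\qquad \widetilde{\mathscr{P}}_I(M)=\operatorname{conv}\{(e_I,\,k-\operatorname{rk}(I)) : I\subseteq E\text{ independent}\}\subseteq\mathbb{R}^{n+1} \] be the independence polytope and the lifted independence polytope of $M$. Then: 1. $\widetilde{\mathscr{P}}_I(M)$ is a generalized permutohedron, that is, a polytope each of whose edges (one-dimensional faces) is parallel to a vector $e_i-e_j$ with $i\neq j$, where $e_1,\dots,e_{n+1}$ are the canonical vectors of $\mathbb{R}^{n+1}$. 2. $\mathscr{P}_I(M)$ and $\widetilde{\mathscr{P}}_I(M)$ are unimodularly (integrally) equivalent: there is an affine map $\varphi:\mathbb{R}^n\to\mathbb{R}^{n+1}$ that restricts to a bijection from $\mathscr{P}_I(M)$ onto $\widetilde{\mathscr{P}}_I(M)$ and to a bijection from $\mathbb{Z}^n\cap\operatorname{aff}\mathscr{P}_I(M)$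 onto $\mathbb{Z}^{n+1}\cap\operatorname{aff}\widetilde{\mathscr{P}}_I(M)$. 3. The two polytopes have the same Ehrhart polynomial: there is a polynomial $p\in\mathbb{Q}[t]$ with $p(t)=\#(t\,\mathscr{P}_I(M)\cap\mathbb{Z}^n)=\#(t\,\widetilde{\mathscr{P}}_I(M)\cap\mathbb{Z}^{n+1})$ for every positive integer $t$. -/

import Mathlib

open scoped Pointwise

noncomputable section

namespace LiftedIndependence

/-- The rank function of a finite matroid, with values in `ℕ`. -/
def rk {n : ℕ} (M : Matroid (Fin n)) (A : Set (Fin n)) : ℕ := (M.eRk A).toNat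

/-- The rank of a finite matroid, i.e. the rank of its ground set. -/
def rank {n : ℕ} (M : Matroid (Fin n)) : ℕ := rk M M.E

/-- The vector `e_A`, the sum of the canonical vectors `e_i` over `i ∈ A`. -/
def indicatorVec {n : ℕ} (A : Set (Fin n)) : Fin n → ℝ := A.indicator (fun _ => 1)

/-- The independence polytope: the convex hull of the vectors `e_I`, `I` independent. -/
def indepPolytope {n : ℕ} (M : Matroid (Fin n)) : Set (Fin n → ℝ) :=
  convexHull ℝ {x | ∃ I : Set (Fin n), M.Indep I ∧ x = indicatorVec I}

/-- The lifted independence polytope in `ℝ^(n+1)`: the convex hull of the vectors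
`(e_I, k - rk I)`, `I` independent, where `k` is the rank of the matroid. -/
def liftedIndepPolytope {n : ℕ} (M : Matroid (Fin n)) : Set (Fin (n + 1) → ℝ) :=
  convexHull ℝ {x | ∃ I : Set (Fin n), M.Indep I ∧
    x = Fin.snoc (α := fun _ => ℝ) (indicatorVec I) ((rank M : ℝ) - (rk M I : ℝ))}

/-- A polytope is the convex hull of finitely many points. -/
def IsPolytope {m : ℕ} (P : Set (Fin m → ℝ)) : Prop :=
  ∃ S : Set (Fin m → ℝ), S.Finite ∧ P = convexHull ℝ S

/-- An edge of a polytope: a nonempty face (the set of maximizers on `P` of some linear functional)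
of dimension one. -/
def IsEdge {m : ℕ} (P F : Set (Fin m → ℝ)) : Prop :=
  F.Nonempty ∧ IsExposed ℝ P F ∧ Module.finrank ℝ (vectorSpan ℝ F) = 1

/-- A generalized permutohedron: a polytope each of whose edges is parallel to a vector
`e_i - e_j` with `i ≠ j`. -/
def IsGeneralizedPermutohedron {m : ℕ} (P : Set (Fin m → ℝ)) : Prop :=
  IsPolytope P ∧ ∀ F : Set (Fin m → ℝ), IsEdge P F →
    ∃ i j : Fin m, i ≠ j ∧
      vectorSpan ℝ F = Submodule.span ℝ {(Pi.single i 1 - Pi.single j 1 : Fin m → ℝ)}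

/-- The lattice `ℤ^m` inside `ℝ^m`. -/
def latticePoints (m : ℕ) : Set (Fin m → ℝ) := {x | ∃ z : Fin m → ℤ, ∀ i, x i = (z i : ℝ)}

/-- Unimodular (integral) equivalence of polytopes: an affine map which restricts to a bijection
of `P` onto `Q` and to a bijection between the lattice points of their affine spans. -/
def UnimodularlyEquivalent {m l : ℕ} (P : Set (Fin m → ℝ)) (Q : Set (Fin l → ℝ)) : Prop :=
  ∃ φ : (Fin m → ℝ) →ᵃ[ℝ] (Fin l → ℝ),
    Set.BijOn φ P Q ∧
    Set.BijOn φ (latticePoints m ∩ (affineSpan ℝ P : Set (Fin m → ℝ)))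
      (latticePoints l ∩ (affineSpan ℝ Q : Set (Fin l → ℝ)))

/-- The number of lattice points in the dilation `t P`. -/
def latticeCount {m : ℕ} (P : Set (Fin m → ℝ)) (t : ℕ) : ℕ :=
  (((t : ℝ) • P) ∩ latticePoints m).ncard

/-- `p` is the Ehrhart polynomial of `P`: it counts the lattice points of all dilations `t P`
with `t` a positive integer. There is at most one such `p`. -/
def IsEhrhartPolynomial {m : ℕ} (P : Set (Fin m → ℝ)) (p : Polynomial ℚ) : Prop :=
  ∀ t : ℕ, 0 < t → p.eval (t : ℚ) = (latticeCount P t : ℚ)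

end LiftedIndependence

end

/-! An independent set satisfies rk(I) = |I|, so the lifted vertices are the images of the e_I under
the affine map x ↦ (x, k - ∑ x_i). This map is injective, and it preserves and reflects integrality
because k is an integer; the unimodular equivalence follows. The t-th dilate of the lifted polytope
is the image of the t-th dilate of the independence polytope under the same map with constant tk, so
the lattice counts agree as well.

For the edges, a linear functional on the lifted polytope is a modular weight on independent sets. A
one-dimensional face contains two distinct maximizing vertices, and `exists_maximal_indep_exchange`
turns them into two maximizers that differ by adding or exchanging a single element. Their
difference is e_i - e_{n+1} or e_i - e_j, and it spans the direction of the edge.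

That an Ehrhart polynomial exists is proved for all lattice polytopes. A simplex is handled by
splitting scaled barycentric coordinates into fractional and integer parts. Otherwise the points
have an affine relation, and `sum_powerset_neg_one_pow_convexHull_eq_zero` writes the indicator
function of the hull as a signed sum of indicators of hulls of fewer points, so that induction
applies without triangulating. -/

namespace LiftedIndependence

/-! ### Euler characteristic of convex sets and an inclusion-exclusion relation -/

open Classical in
/-- An integer combination of indicator functions of closed intervals that vanishes identically
has coefficient sum zero. -/
theorem sum_eq_zero_of_sum_Icc_eq_zero {ι : Type*} (s : Finset ι) (a : ι → ℤ) (l r : ι → ℝ)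
    (hlr : ∀ i ∈ s, l i ≤ r i)
    (h : ∀ c, ∑ i ∈ s, (if l i ≤ c ∧ c ≤ r i then a i else 0) = 0) : ∑ i ∈ s, a i = 0 := by
  rw [← Finset.sum_fiberwise_of_maps_to (t := s.image r) (g := r)
    (fun i hi => Finset.mem_image_of_mem r hi)]
  refine Finset.sum_eq_zero fun c _ => ?_
  -- Choose d > c so close to c that no endpoint lies in (c, d]. Subtracting the relation at d from
  -- the one at c then leaves exactly the intervals whose right endpoint is c.
  have hev : ∀ᶠ d in nhdsWithin c (Set.Ioi c), c < d ∧
      ∀ i ∈ s, (c < l i → d < l i) ∧ (c < r i → d < r i) := by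
    refine Filter.Eventually.and self_mem_nhdsWithin ?_
    rw [Filter.eventually_all_finset]
    intro i _
    have aux : ∀ b : ℝ, ∀ᶠ d in nhdsWithin c (Set.Ioi c), c < b → d < b := by
      intro b
      by_cases hb : c < b
      · exact ((eventually_lt_nhds hb).filter_mono nhdsWithin_le_nhds).mono fun d hd _ => hd
      · exact Filter.Eventually.of_forall fun d h => absurd h hb
    exact (aux _).and (aux _)
  obtain ⟨d, hcd, hd⟩ := hev.exists
  have := congrArg₂ (· - ·) (h c) (h d)
  simp only [sub_zero, ← Finset.sum_sub_distrib] at this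
  rw [← this, Finset.sum_filter]
  refine Finset.sum_congr rfl fun i hi => ?_
  obtain ⟨h1, h2⟩ := hd i hi
  have h3 := hlr i hi
  by_cases hrc : r i = c
  · rw [if_pos hrc, if_pos ⟨by linarith, by linarith⟩, if_neg (by rintro ⟨_, _⟩; linarith), sub_zero]
  · rw [if_neg hrc]
    have : (l i ≤ c ∧ c ≤ r i) ↔ (l i ≤ d ∧ d ≤ r i) := by
      constructor
      · rintro ⟨ha, hb⟩
        exact ⟨by linarith, (h2 (lt_of_le_of_ne hb (Ne.symm hrc))).le⟩
      · rintro ⟨ha, hb⟩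
        refine ⟨?_, by linarith⟩
        by_contra hcon
        linarith [h1 (not_le.1 hcon)]
    simp only [this, sub_self]

open Classical in
/-- The Euler characteristic of compact convex sets: an integer combination of indicator functions
of compact convex sets that vanishes identically has coefficient sum zero, the coefficients of
empty sets being disregarded. -/
theorem sum_nonempty_eq_zero_of_sum_indicator_eq_zero {ι : Type*} (s : Finset ι) (a : ι → ℤ)
    (N : ℕ) (K : ι → Set (Fin N → ℝ)) (hconv : ∀ i ∈ s, Convex ℝ (K i))
    (hcomp : ∀ i ∈ s, IsCompact (K i))
    (h : ∀ y, ∑ i ∈ s, (if y ∈ K i then a i else 0) = 0) :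
    ∑ i ∈ s, (if (K i).Nonempty then a i else 0) = 0 := by
  induction N with
  | zero =>
    refine Eq.trans ?_ (h default)
    refine Finset.sum_congr rfl fun i _ => ?_
    have : (K i).Nonempty ↔ default ∈ K i :=
      ⟨fun ⟨y, hy⟩ => Subsingleton.elim y default ▸ hy, fun hy => ⟨_, hy⟩⟩
    simp only [this]
  | succ N ih =>
    -- Induction on dimension: the slices at first coordinate c satisfy the same relation, and a
    -- slice is nonempty exactly when c lies in the projection to the first coordinate. The
    -- projections are compact intervals, to which the one-dimensional case applies.
    have hslice : ∀ c : ℝ, ∑ i ∈ s, (if c ∈ (fun y => y 0) '' K i then a i else 0) = 0 := by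
      intro c
      have hcons : Topology.IsClosedEmbedding
          (fun y : Fin N → ℝ => (Fin.cons c y : Fin (N + 1) → ℝ)) := by
        refine Topology.IsClosedEmbedding.of_continuous_injective_isClosedMap ?_ ?_ ?_
        · fun_prop
        · exact Fin.cons_right_injective (α := fun _ => ℝ) c
        · intro S hS
          have : (fun y : Fin N → ℝ => (Fin.cons c y : Fin (N + 1) → ℝ)) '' S
              = {z | z 0 = c} ∩ (fun z => Fin.tail z) ⁻¹' S := by
            ext z
            constructor
            · rintro ⟨y, hy, rfl⟩
              exact ⟨rfl, by simpa using hy⟩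
            · rintro ⟨rfl, hz⟩
              exact ⟨Fin.tail z, hz, Fin.cons_self_tail z⟩
          rw [this]
          refine IsClosed.inter (isClosed_eq (continuous_apply 0) continuous_const)
            (hS.preimage ?_)
          exact continuous_pi fun i => continuous_apply _
      have := ih (fun i => (fun y : Fin N → ℝ => (Fin.cons c y : Fin (N + 1) → ℝ)) ⁻¹' K i)
        (fun i hi => by
          intro x hx y hy p q hp hq hpq
          have := hconv i hi hx hy hp hq hpq
          simp only [Set.mem_preimage]
          convert this using 1
          ext j
          refine Fin.cases ?_ (fun j => ?_) j
          · simp [← add_mul, hpq]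
          · simp)
        (fun i hi => hcons.isCompact_preimage (hcomp i hi))
        (fun y => h _)
      refine Eq.trans ?_ this
      refine Finset.sum_congr rfl fun i _ => ?_
      have : c ∈ (fun y => y 0) '' K i ↔
          ((fun y : Fin N → ℝ => (Fin.cons c y : Fin (N + 1) → ℝ)) ⁻¹' K i).Nonempty := by
        constructor
        · rintro ⟨z, hz, rfl⟩
          exact ⟨Fin.tail z, by simpa using hz⟩
        · rintro ⟨y, hy⟩
          exact ⟨_, hy, rfl⟩
      simp only [this]
    rw [← Finset.sum_filter]
    have hIcc : ∀ i ∈ s, (K i).Nonempty → ∃ l r : ℝ, l ≤ r ∧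
        (fun y => y 0) '' K i = Set.Icc l r := by
      intro i hi hne
      have hc : IsCompact ((fun y : Fin (N + 1) → ℝ => y 0) '' K i) :=
        (hcomp i hi).image (continuous_apply 0)
      have hcv : Convex ℝ ((fun y : Fin (N + 1) → ℝ => y 0) '' K i) :=
        (hconv i hi).linear_image (LinearMap.proj 0)
      have := eq_Icc_of_connected_compact
        (hcv.isConnected (hne.image _)) hc
      refine ⟨_, _, ?_, this⟩
      rw [← Set.nonempty_Icc, ← this]
      exact hne.image _
    choose! l r hlr hI using hIcc
    refine sum_eq_zero_of_sum_Icc_eq_zero _ a l r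
      (fun i hi => hlr i (Finset.mem_filter.1 hi).1 (Finset.mem_filter.1 hi).2) fun c => ?_
    rw [Finset.sum_filter]
    refine Eq.trans ?_ (hslice c)
    refine Finset.sum_congr rfl fun i hi => ?_
    by_cases hne : (K i).Nonempty
    · rw [if_pos hne, hI i hi hne]
      simp only [Set.mem_Icc]
    · rw [if_neg hne, Set.not_nonempty_iff_eq_empty.1 hne, Set.image_empty]
      simp

open Classical in
/-- For a family of points with a nontrivial affine relation, the convex hulls of the subfamilies
obtained by omitting points with positive coefficient satisfy an inclusion-exclusion relation. -/
theorem sum_powerset_neg_one_pow_convexHull_eq_zero {N m : ℕ} (v : Fin N → Fin m → ℝ)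
    (lam : Fin N → ℝ) (hlam0 : ∑ i, lam i = 0) (hlamv : ∑ i, lam i • v i = 0)
    (hpos : ∃ i, 0 < lam i) (x : Fin m → ℝ) :
    ∑ S ∈ (Finset.univ.filter fun i => 0 < lam i).powerset,
      (if ∃ μ : Fin N → ℝ, (∀ i, 0 ≤ μ i) ∧ ∑ i, μ i = 1 ∧ ∑ i, μ i • v i = x ∧ ∀ i ∈ S, μ i = 0
        then (-1 : ℤ) ^ S.card else 0) = 0 := by
  obtain ⟨k, hk⟩ := hpos
  set K : Finset (Fin N) → Set (Fin N → ℝ) := fun S =>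
    {μ | (∀ i, 0 ≤ μ i) ∧ ∑ i, μ i = 1 ∧ ∑ i, μ i • v i = x ∧ ∀ i ∈ S, μ i = 0} with hK
  -- The projection along `lam` that kills coordinate `k`. The Euler characteristic is applied to
  -- the images of the `K S`, because their indicator functions cancel pointwise.
  let π : (Fin N → ℝ) →ₗ[ℝ] (Fin N → ℝ) :=
    LinearMap.id - (((lam k)⁻¹ • (LinearMap.proj k : (Fin N → ℝ) →ₗ[ℝ] ℝ)).smulRight lam)
  have hπ : ∀ μ, π μ = μ - ((lam k)⁻¹ * μ k) • lam := fun μ => by simp [π]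
  have hπlam : ∀ μ (c : ℝ), π (μ + c • lam) = π μ := by
    intro μ c
    rw [hπ, hπ]
    ext i
    simp
    field_simp
    ring
  have hconv : ∀ S, Convex ℝ (K S) := by
    rintro S μ ⟨h1, h2, h3, h4⟩ ν ⟨h1', h2', h3', h4'⟩ p q hp hq hpq
    refine ⟨fun i => ?_, ?_, ?_, fun i hi => ?_⟩
    · have := h1 i
      have := h1' i
      simp only [Pi.add_apply, Pi.smul_apply, smul_eq_mul]
      positivity
    · simp only [Pi.add_apply, Pi.smul_apply, smul_eq_mul, Finset.sum_add_distrib,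
        ← Finset.mul_sum, h2, h2', mul_one, hpq]
    · simp only [Pi.add_apply, Pi.smul_apply, smul_eq_mul, add_smul, mul_smul,
        Finset.sum_add_distrib, ← Finset.smul_sum, h3, h3']
      rw [← add_smul, hpq, one_smul]
    · simp [h4 i hi, h4' i hi]
  have hcomp : ∀ S, IsCompact (K S) := by
    intro S
    refine (isCompact_stdSimplex ℝ (Fin N)).of_isClosed_subset ?_ fun μ h => ⟨h.1, h.2.1⟩
    have : K S = (⋂ i, {μ | 0 ≤ μ i}) ∩ ({μ | ∑ i, μ i = 1} ∩ ({μ | ∑ i, μ i • v i = x} ∩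
        ⋂ i ∈ S, {μ | μ i = 0})) := by
      ext μ
      simp [hK]
    rw [this]
    refine (isClosed_iInter fun i => isClosed_le continuous_const (continuous_apply i)).inter
      ((isClosed_eq (by fun_prop) continuous_const).inter
      ((isClosed_eq (by fun_prop) continuous_const).inter
      (isClosed_biInter fun i _ => isClosed_eq (continuous_apply i) continuous_const)))
  have key := sum_nonempty_eq_zero_of_sum_indicator_eq_zero
    (Finset.univ.filter fun i => 0 < lam i).powerset (fun S => (-1 : ℤ) ^ S.card) N
    (fun S => π '' K S) (fun S _ => (hconv S).linear_image π)
    (fun S _ => (hcomp S).image π.continuous_of_finiteDimensional) ?_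
  · simp only [Set.image_nonempty] at key
    exact key
  intro y
  by_cases hy : y ∈ π '' K ∅
  swap
  · refine Finset.sum_eq_zero fun S _ => if_neg fun h => hy ?_
    have hsub : K S ⊆ K ∅ := fun μ h => ⟨h.1, h.2.1, h.2.2.1, by simp⟩
    exact Set.image_mono hsub h
  obtain ⟨μ, ⟨h1, h2, h3, -⟩, rfl⟩ := hy
  -- Move from `μ` in direction `-lam` until the first coordinate with `0 < lam i` vanishes, at
  -- index `j`. The result `μ'` is the extreme point of the fibre of `K ∅` in that direction.
  obtain ⟨j, hj, hmin⟩ := Finset.exists_min_image (Finset.univ.filter fun i => 0 < lam i)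
    (fun i => μ i / lam i) ⟨k, by simpa using hk⟩
  simp only [Finset.mem_filter, Finset.mem_univ, true_and] at hj hmin
  set μ' := μ + (-(μ j / lam j)) • lam with hμ'
  have hμ'j : μ' j = 0 := by
    simp [hμ']
    field_simp
    ring
  have hμ'K : (∀ i, 0 ≤ μ' i) ∧ ∑ i, μ' i = 1 ∧ ∑ i, μ' i • v i = x := by
    refine ⟨fun i => ?_, ?_, ?_⟩
    · have hq : 0 ≤ μ j / lam j := div_nonneg (h1 j) hj.le
      simp only [hμ', Pi.add_apply, Pi.smul_apply, smul_eq_mul]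
      by_cases hi : 0 < lam i
      · have := hmin i hi
        rw [le_div_iff₀ hi] at this
        linarith
      · nlinarith [h1 i]
    · simp only [hμ', Pi.add_apply, Pi.smul_apply, smul_eq_mul, Finset.sum_add_distrib,
        ← Finset.mul_sum, hlam0, h2, mul_zero, add_zero]
    · simp only [hμ', Pi.add_apply, Pi.smul_apply, smul_eq_mul, add_smul, mul_smul,
        Finset.sum_add_distrib, ← Finset.smul_sum, hlamv, h3, smul_zero, add_zero]
  -- Any `ν` in the same fibre is `μ' + c • lam`, and `0 ≤ ν j` forces `0 ≤ c`. So if `ν` vanishes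
  -- on `S`, then `μ'` does too: the fibre meets `K S` exactly when `S` consists of zeros of `μ'`.
  -- These zeros include `j`, so the alternating sum over their subsets vanishes.
  have hmem : ∀ S ∈ (Finset.univ.filter fun i => 0 < lam i).powerset,
      (π μ ∈ π '' K S ↔ S ∈ (Finset.univ.filter fun i => 0 < lam i ∧ μ' i = 0).powerset) := by
    intro S hS
    rw [Finset.mem_powerset] at hS ⊢
    have hSpos : ∀ i ∈ S, 0 < lam i := fun i hi => (Finset.mem_filter.1 (hS hi)).2
    constructor
    · rintro ⟨ν, ⟨n1, n2, n3, n4⟩, hν⟩ i hi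
      rw [← hπlam μ (-(μ j / lam j)), ← hμ', hπ, hπ] at hν
      have hdiff : ∀ i, ν i = μ' i + ((lam k)⁻¹ * ν k - (lam k)⁻¹ * μ' k) * lam i := by
        intro i
        have := congrFun hν i
        simp only [Pi.sub_apply, Pi.smul_apply, smul_eq_mul] at this
        linarith
      set c := (lam k)⁻¹ * ν k - (lam k)⁻¹ * μ' k
      have hc0 : 0 ≤ c := by
        have h5 := hdiff j
        rw [hμ'j, zero_add] at h5
        exact nonneg_of_mul_nonneg_left (h5 ▸ n1 j) hj
      have h6 := hdiff i
      rw [n4 i hi] at h6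
      have h7 := mul_nonneg hc0 (hSpos i hi).le
      have h8 := hμ'K.1 i
      simp only [Finset.mem_filter, Finset.mem_univ, true_and]
      exact ⟨hSpos i hi, by linarith⟩
    · intro hS'
      refine ⟨μ', ⟨hμ'K.1, hμ'K.2.1, hμ'K.2.2, fun i hi => (Finset.mem_filter.1 (hS' hi)).2.2⟩, ?_⟩
      rw [hμ', hπlam]
  rw [Finset.sum_congr rfl fun S hS => by rw [if_congr (hmem S hS) rfl rfl], ← Finset.sum_filter]
  have hfil : (Finset.univ.filter fun i => 0 < lam i).powerset.filter
      (· ∈ (Finset.univ.filter fun i => 0 < lam i ∧ μ' i = 0).powerset)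
      = (Finset.univ.filter fun i => 0 < lam i ∧ μ' i = 0).powerset := by
    ext S
    simp only [Finset.mem_filter, Finset.mem_powerset, and_iff_right_iff_imp]
    intro h i hi
    have := h hi
    simp only [Finset.mem_filter, Finset.mem_univ, true_and] at this ⊢
    exact this.1
  rw [hfil]
  exact Finset.sum_powerset_neg_one_pow_card_of_nonempty ⟨j, by simp [hj, hμ'j]⟩

/-! ### Lattice points and convex coefficients -/

theorem mem_latticePoints_add {m : ℕ} {x y : Fin m → ℝ} (hx : x ∈ latticePoints m)
    (hy : y ∈ latticePoints m) : x + y ∈ latticePoints m := by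
  obtain ⟨a, ha⟩ := hx
  obtain ⟨b, hb⟩ := hy
  exact ⟨a + b, fun i => by simp [ha, hb]⟩

theorem mem_latticePoints_sum_smul {m N : ℕ} {v : Fin N → Fin m → ℝ}
    (hv : ∀ i, v i ∈ latticePoints m) (z : Fin N → ℤ) :
    ∑ i, (z i : ℝ) • v i ∈ latticePoints m := by
  choose a ha using hv
  exact ⟨∑ i, z i • a i, fun j => by simp [ha]⟩

theorem finite_inter_latticePoints {m : ℕ} {S : Set (Fin m → ℝ)} (hS : Bornology.IsBounded S) :
    (S ∩ latticePoints m).Finite := by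
  obtain ⟨R, hR⟩ := hS.subset_closedBall 0
  refine ((Set.finite_Icc (fun _ : Fin m => -⌈R⌉) (fun _ => ⌈R⌉)).image
    fun z i => (z i : ℝ)).subset ?_
  rintro x ⟨hxS, z, hz⟩
  have hx : ‖x‖ ≤ R := by simpa using hR hxS
  have hi : ∀ i, |(z i : ℝ)| ≤ (⌈R⌉ : ℝ) := fun i => by
    rw [← hz i]
    exact ((norm_le_pi_norm x i).trans hx).trans (Int.le_ceil R)
  refine ⟨z, ⟨fun i => ?_, fun i => ?_⟩, funext fun i => (hz i).symm⟩
  · have := (abs_le.1 (hi i)).1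
    exact_mod_cast this
  · have := (abs_le.1 (hi i)).2
    exact_mod_cast this

/-- Places the coefficients for all subfamilies in one space, where omitting points means that
coordinates vanish. The family need not be injective. -/
theorem mem_convexHull_image_compl_iff {N m : ℕ} (v : Fin N → Fin m → ℝ) (S : Finset (Fin N))
    (x : Fin m → ℝ) :
    x ∈ convexHull ℝ (v '' (Sᶜ : Finset (Fin N))) ↔
      ∃ μ : Fin N → ℝ, (∀ i, 0 ≤ μ i) ∧ ∑ i, μ i = 1 ∧ ∑ i, μ i • v i = x ∧
        ∀ i ∈ S, μ i = 0 := by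
  constructor
  · intro hx
    have hsub : convexHull ℝ (v '' (Sᶜ : Finset (Fin N))) ⊆ {x | ∃ μ : Fin N → ℝ,
        (∀ i, 0 ≤ μ i) ∧ ∑ i, μ i = 1 ∧ ∑ i, μ i • v i = x ∧ ∀ i ∈ S, μ i = 0} := by
      refine convexHull_min ?_ ?_
      · rintro _ ⟨i, hi, rfl⟩
        have hi : i ∉ S := by simpa using hi
        refine ⟨Pi.single i 1, fun j => ?_, ?_, ?_, fun j hj => ?_⟩
        · rw [Pi.single_apply]
          split_ifs <;> norm_num
        · simp
        · simp [Pi.single_apply, ite_smul]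
        · exact Pi.single_eq_of_ne (ne_of_mem_of_not_mem hj hi) _
      · rintro _ ⟨μ, h1, h2, rfl, h4⟩ _ ⟨ν, h1', h2', rfl, h4'⟩ p q hp hq hpq
        refine ⟨p • μ + q • ν, fun i => ?_, ?_, ?_, fun i hi => ?_⟩
        · have := h1 i
          have := h1' i
          simp only [Pi.add_apply, Pi.smul_apply, smul_eq_mul]
          positivity
        · simp only [Pi.add_apply, Pi.smul_apply, smul_eq_mul, Finset.sum_add_distrib,
            ← Finset.mul_sum, h2, h2', mul_one, hpq]
        · simp only [Pi.add_apply, Pi.smul_apply, smul_eq_mul, add_smul, mul_smul,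
            Finset.sum_add_distrib, ← Finset.smul_sum]
        · simp [h4 i hi, h4' i hi]
    exact hsub hx
  · rintro ⟨μ, h1, h2, rfl, h4⟩
    have e1 : ∑ i ∈ Sᶜ, μ i = 1 := by
      rw [← h2]
      refine Finset.sum_subset (Finset.subset_univ _) fun i _ hi => h4 i (by simpa using hi)
    have e2 : ∑ i ∈ Sᶜ, μ i • v i = ∑ i, μ i • v i := by
      refine Finset.sum_subset (Finset.subset_univ _) fun i _ hi => ?_
      rw [h4 i (by simpa using hi), zero_smul]
    rw [← e2]
    exact (convex_convexHull ℝ _).sum_mem (fun i _ => h1 i) e1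
      fun i hi => subset_convexHull ℝ _ ⟨i, hi, rfl⟩

/-! ### Ehrhart's theorem for simplices -/

/-- The nonnegative coefficient vectors of total mass `t` whose combination of the vectors `v i`
is a lattice point. -/
def coeffSet {N m : ℕ} (v : Fin N → Fin m → ℝ) (t : ℕ) : Set (Fin N → ℝ) :=
  {c | (∀ i, 0 ≤ c i) ∧ ∑ i, c i = t ∧ ∑ i, c i • v i ∈ latticePoints m}

/-- The coefficient vectors in the half-open unit cube of total mass `h` whose combination of the
vectors `v i` is a lattice point. -/
def boxSet {N m : ℕ} (v : Fin N → Fin m → ℝ) (h : ℕ) : Set (Fin N → ℝ) :=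
  {c | c ∈ coeffSet v h ∧ ∀ i, c i < 1}

theorem injOn_coeffSet {N m : ℕ} (v : Fin N → Fin m → ℝ)
    (hind : ∀ lam : Fin N → ℝ, ∑ i, lam i = 0 → ∑ i, lam i • v i = 0 → lam = 0) (t : ℕ) :
    Set.InjOn (fun c : Fin N → ℝ => ∑ i, c i • v i) (coeffSet v t) := by
  intro c hc d hd hcd
  have := hind (c - d) (by simp [hc.2.1, hd.2.1]) (by
    simp only [Pi.sub_apply, sub_smul, Finset.sum_sub_distrib]
    exact sub_eq_zero.2 hcd)
  exact sub_eq_zero.1 this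

theorem finite_boxSet {N m : ℕ} (v : Fin N → Fin m → ℝ)
    (hind : ∀ lam : Fin N → ℝ, ∑ i, lam i = 0 → ∑ i, lam i • v i = 0 → lam = 0) (h : ℕ) :
    (boxSet v h).Finite := by
  refine Set.Finite.of_finite_image ?_ ((injOn_coeffSet v hind h).mono fun c hc => hc.1)
  have hcomp : IsCompact ((fun c : Fin N → ℝ => ∑ i, c i • v i) '' Set.Icc 0 1) :=
    isCompact_Icc.image (by fun_prop)
  refine (finite_inter_latticePoints hcomp.isBounded).subset ?_
  rintro _ ⟨c, hc, rfl⟩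
  exact ⟨⟨c, ⟨hc.1.1, fun i => (hc.2 i).le⟩, rfl⟩, hc.1.2.2⟩

theorem latticeCount_convexHull_range {N m : ℕ} (v : Fin N → Fin m → ℝ)
    (hind : ∀ lam : Fin N → ℝ, ∑ i, lam i = 0 → ∑ i, lam i • v i = 0 → lam = 0)
    {t : ℕ} (ht : 0 < t) :
    latticeCount (convexHull ℝ (Set.range v)) t = (coeffSet v t).ncard := by
  have ht' : (t : ℝ) ≠ 0 := by positivity
  have himg : ((t : ℝ) • convexHull ℝ (Set.range v)) ∩ latticePoints m
      = (fun c : Fin N → ℝ => ∑ i, c i • v i) '' coeffSet v t := by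
    ext x
    have hmem := mem_convexHull_image_compl_iff v ∅ ((t : ℝ)⁻¹ • x)
    simp only [Finset.compl_empty, Finset.coe_univ, Set.image_univ, Finset.notMem_empty,
      false_imp_iff, implies_true, and_true] at hmem
    rw [Set.mem_inter_iff, Set.mem_smul_set_iff_inv_smul_mem₀ ht', hmem]
    constructor
    · rintro ⟨⟨μ, h1, h2, h3⟩, hx⟩
      have h4 : ∑ i, ((t : ℝ) • μ) i • v i = x := by
        simp only [Pi.smul_apply, smul_eq_mul, mul_smul, ← Finset.smul_sum, h3,
          smul_inv_smul₀ ht']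
      refine ⟨(t : ℝ) • μ, ⟨fun i => ?_, ?_, by rw [h4]; exact hx⟩, h4⟩
      · exact mul_nonneg (Nat.cast_nonneg t) (h1 i)
      · simp only [Pi.smul_apply, smul_eq_mul, ← Finset.mul_sum, h2, mul_one]
    · rintro ⟨c, ⟨h1, h2, h3⟩, rfl⟩
      refine ⟨⟨(t : ℝ)⁻¹ • c, fun i => ?_, ?_, ?_⟩, h3⟩
      · exact mul_nonneg (by positivity) (h1 i)
      · simp only [Pi.smul_apply, smul_eq_mul, ← Finset.mul_sum, h2, inv_mul_cancel₀ ht']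
      · simp only [Pi.smul_apply, smul_eq_mul, mul_smul, ← Finset.smul_sum]
  rw [latticeCount, himg]
  exact (injOn_coeffSet v hind t).ncard_image

/-- Stars and bars. The bound `h ≤ d` keeps the formula valid for `t < h`: the subtraction is not
truncated, and the upper index drops below `d`, giving zero. -/
theorem card_sum_add_eq (d h t : ℕ) (hh : h ≤ d) :
    Nat.card {n : Fin (d + 1) → ℕ // ∑ i, n i + h = t} = (d + t - h).choose d := by
  rcases le_or_gt h t with hht | hht
  · have e : {n : Fin (d + 1) → ℕ // ∑ i, n i + h = t} ≃ Sym (Fin (d + 1)) (t - h) :=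
      (Equiv.subtypeEquivRight fun n => by omega).trans
        (Sym.equivNatSumOfFintype (Fin (d + 1)) (t - h)).symm
    rw [Nat.card_congr e, Nat.card_eq_fintype_card, Sym.card_sym_eq_choose, Fintype.card_fin,
      ← Nat.choose_symm (by omega)]
    congr 1 <;> omega
  · have : IsEmpty {n : Fin (d + 1) → ℕ // ∑ i, n i + h = t} := ⟨fun n => by have := n.2; omega⟩
    rw [Nat.card_of_isEmpty, Nat.choose_eq_zero_of_lt (by omega)]

/-- Each coefficient vector splits uniquely into fractional parts and floors. The `v i` are lattice
points, so the floors do not affect integrality. The fractional mass is an integer `h` below `d +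
1`, and the floors distribute the remaining mass `t - h` freely. -/
theorem ncard_coeffSet {d m : ℕ} (v : Fin (d + 1) → Fin m → ℝ)
    (hv : ∀ i, v i ∈ latticePoints m)
    (hind : ∀ lam : Fin (d + 1) → ℝ, ∑ i, lam i = 0 → ∑ i, lam i • v i = 0 → lam = 0) (t : ℕ) :
    (coeffSet v t).ncard = ∑ h : Fin (d + 1), (boxSet v h).ncard * (d + t - h).choose d := by
  let F : (Σ h : Fin (d + 1), boxSet v h × {n : Fin (d + 1) → ℕ // ∑ i, n i + h = t}) →
      coeffSet v t := fun x => ⟨fun i => x.2.1.1 i + x.2.2.1 i, by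
    obtain ⟨h, ⟨f, ⟨hf1, hf2, hf3⟩, hf4⟩, ⟨n, hn⟩⟩ := x
    refine ⟨fun i => add_nonneg (hf1 i) (Nat.cast_nonneg _), ?_, ?_⟩
    · simp only [Finset.sum_add_distrib, hf2]
      rw [← hn]
      push_cast
      ring
    · simp only [add_smul, Finset.sum_add_distrib]
      refine mem_latticePoints_add hf3 ?_
      simpa using mem_latticePoints_sum_smul hv (fun i => (n i : ℤ))⟩
  have hF : Function.Bijective F := by
    constructor
    · rintro ⟨h, ⟨f, ⟨hf1, hf2, hf3⟩, hf4⟩, ⟨n, hn⟩⟩ ⟨h', ⟨f', ⟨hf1', hf2', hf3'⟩, hf4'⟩, ⟨n', hn'⟩⟩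
        hxy
      have hxy : ∀ i, f i + n i = f' i + n' i := fun i => congrFun (congrArg Subtype.val hxy) i
      have hnn : n = n' := by
        ext i
        have h1 := hxy i
        have h2 := hf1 i
        have h3 := hf1' i
        have h4 := hf4 i
        have h5 := hf4' i
        have h6 : (n i : ℝ) < n' i + 1 := by linarith
        have h7 : (n' i : ℝ) < n i + 1 := by linarith
        have h6' : n i < n' i + 1 := by exact_mod_cast h6
        have h7' : n' i < n i + 1 := by exact_mod_cast h7
        omega
      subst hnn
      have hff : f = f' := funext fun i => by simpa using hxy i
      subst hff
      have hhh : h = h' := Fin.ext (by omega)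
      subst hhh
      rfl
    · rintro ⟨c, hc1, hc2, hc3⟩
      have hfl : ∀ i, ((⌊c i⌋₊ : ℕ) : ℝ) ≤ c i := fun i => Nat.floor_le (hc1 i)
      have hlt : ∀ i, c i < ⌊c i⌋₊ + 1 := fun i => Nat.lt_floor_add_one _
      have hle : ∑ i, ⌊c i⌋₊ ≤ t := by
        have : (∑ i, (⌊c i⌋₊ : ℝ)) ≤ t := hc2 ▸ Finset.sum_le_sum fun i _ => hfl i
        exact_mod_cast this
      obtain ⟨h, hh⟩ := Nat.exists_eq_add_of_le hle
      have hsum : ∑ i, (c i - ⌊c i⌋₊) = h := by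
        rw [Finset.sum_sub_distrib, hc2, hh]
        push_cast
        ring
      have hd : h < d + 1 := by
        have : (h : ℝ) < ∑ i : Fin (d + 1), 1 := by
          rw [← hsum]
          exact Finset.sum_lt_sum_of_nonempty Finset.univ_nonempty fun i _ => by linarith [hlt i]
        simp only [Finset.sum_const, Finset.card_univ, Fintype.card_fin, nsmul_eq_mul,
          mul_one] at this
        exact_mod_cast this
      refine ⟨⟨⟨h, hd⟩, ⟨fun i => c i - ⌊c i⌋₊, ⟨fun i => sub_nonneg.2 (hfl i), hsum, ?_⟩,
        fun i => by linarith [hlt i]⟩, ⟨fun i => ⌊c i⌋₊, hh.symm⟩⟩, ?_⟩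
      · have := mem_latticePoints_add hc3
          (mem_latticePoints_sum_smul hv (fun i => -(⌊c i⌋₊ : ℤ)))
        rw [← Finset.sum_add_distrib] at this
        convert this using 2 with i
        push_cast
        rw [← add_smul, sub_eq_add_neg]
      · exact Subtype.ext (funext fun i => by simp [F])
  have hcard := Nat.card_congr (Equiv.ofBijective F hF)
  have : ∀ h : Fin (d + 1), Nat.card (boxSet v h × {n : Fin (d + 1) → ℕ // ∑ i, n i + h = t})
      = (boxSet v h).ncard * (d + t - h).choose d := fun h => by
    rw [Nat.card_prod, card_sum_add_eq d h t (Nat.lt_succ_iff.1 h.2), Nat.card_coe_set_eq]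
  have hfin : ∀ h : Fin (d + 1), Finite (boxSet v h) := fun h => (finite_boxSet v hind h).to_subtype
  have hfin' : ∀ h : Fin (d + 1), Finite {n : Fin (d + 1) → ℕ // ∑ i, n i + h = t} := fun h =>
    ((Set.finite_Iic (fun _ : Fin (d + 1) => t)).subset fun n (hn : ∑ i, n i + h = t) i =>
      (Finset.single_le_sum (fun j _ => Nat.zero_le (n j)) (Finset.mem_univ i)).trans
        (hn ▸ Nat.le_add_right _ _)).to_subtype
  rw [← Nat.card_coe_set_eq, ← hcard, Nat.card_sigma]
  exact Finset.sum_congr rfl fun h _ => this h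

/-- Ehrhart's theorem for lattice simplices. -/
theorem exists_isEhrhartPolynomial_of_affineIndependent {N m : ℕ} (v : Fin N → Fin m → ℝ)
    (hv : ∀ i, v i ∈ latticePoints m)
    (hind : ∀ lam : Fin N → ℝ, ∑ i, lam i = 0 → ∑ i, lam i • v i = 0 → lam = 0) :
    ∃ p, IsEhrhartPolynomial (convexHull ℝ (Set.range v)) p := by
  rcases N with _ | d
  · exact ⟨0, fun t _ => by simp [latticeCount, Set.range_eq_empty]⟩
  -- The binomial coefficient `(d + t - h).choose d` is a falling factorial of `d + t - h` divided
  -- by `d!`, hence polynomial in `t`.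
  refine ⟨∑ h : Fin (d + 1), Polynomial.C (((boxSet v h).ncard : ℚ) / d.factorial) *
    (descPochhammer ℚ d).comp (Polynomial.X + Polynomial.C ((d : ℚ) - (h : ℕ))), fun t ht => ?_⟩
  rw [latticeCount_convexHull_range v hind ht, ncard_coeffSet v hv hind, Polynomial.eval_finsetSum]
  push_cast
  refine Finset.sum_congr rfl fun h _ => ?_
  have hh := h.2
  rw [Nat.cast_choose_eq_descPochhammer_div ℚ, Nat.cast_sub (by omega)]
  simp only [Polynomial.eval_mul, Polynomial.eval_C, Polynomial.eval_comp, Polynomial.eval_add,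
    Polynomial.eval_X]
  push_cast
  rw [show (t : ℚ) + (d - (h : ℕ)) = d + t - (h : ℕ) by ring]
  ring

/-! ### Ehrhart's theorem for lattice polytopes -/

/-- Ehrhart's theorem for lattice polytopes. -/
theorem exists_isEhrhartPolynomial {m : ℕ} (V : Finset (Fin m → ℝ))
    (hV : ∀ x ∈ V, x ∈ latticePoints m) :
    ∃ p, IsEhrhartPolynomial (convexHull ℝ (V : Set (Fin m → ℝ))) p := by
  classical
  induction hN : V.card using Nat.strong_induction_on generalizing V with
  | _ N ih =>
  let v : Fin N → Fin m → ℝ := fun i => (V.equivFinOfCardEq hN).symm i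
  have hvV : ∀ i, v i ∈ V := fun i => ((V.equivFinOfCardEq hN).symm i).2
  have hrange : Set.range v = V := by
    ext x
    constructor
    · rintro ⟨i, rfl⟩
      exact hvV i
    · intro hx
      exact ⟨V.equivFinOfCardEq hN ⟨x, hx⟩, by simp [v]⟩
  by_cases hind : ∀ lam : Fin N → ℝ, ∑ i, lam i = 0 → ∑ i, lam i • v i = 0 → lam = 0
  · rw [← hrange]
    exact exists_isEhrhartPolynomial_of_affineIndependent v (fun i => hV _ (hvV i)) hind
  push Not at hind
  obtain ⟨lam, hlam0, hlamv, hne⟩ := hind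
  have hpos : ∃ i, 0 < lam i := by
    obtain ⟨i, hi⟩ := Function.ne_iff.1 hne
    obtain ⟨j, -, hj⟩ := Finset.exists_pos_of_sum_zero_of_exists_nonzero lam hlam0
      ⟨i, Finset.mem_univ i, hi⟩
    exact ⟨j, hj⟩
  have hex : ∀ S : Finset (Fin N), ∃ p, S.Nonempty →
      IsEhrhartPolynomial (convexHull ℝ (v '' (Sᶜ : Finset (Fin N)))) p := by
    intro S
    by_cases hS : S.Nonempty
    · have hcard : (Sᶜ.image v).card < N := by
        refine Finset.card_image_le.trans_lt ?_
        have h1 := S.card_add_card_compl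
        have h2 := hS.card_pos
        rw [Fintype.card_fin] at h1
        omega
      obtain ⟨p, hp⟩ := ih _ hcard (Sᶜ.image v) (fun x hx => by
        obtain ⟨i, -, rfl⟩ := Finset.mem_image.1 hx
        exact hV _ (hvV i)) rfl
      rw [Finset.coe_image] at hp
      exact ⟨p, fun _ => hp⟩
    · exact ⟨0, fun h => absurd h hS⟩
  choose p hp using hex
  set P := (Finset.univ.filter fun i => 0 < lam i).powerset with hP
  -- The inclusion-exclusion relation solved for its `S = ∅` term, which is the polytope itself.
  refine ⟨-∑ S ∈ P.erase ∅, (-1) ^ S.card * p S, fun t ht => ?_⟩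
  have ht' : (t : ℝ) ≠ 0 := by positivity
  have hfin : (((t : ℝ) • convexHull ℝ (V : Set (Fin m → ℝ))) ∩ latticePoints m).Finite :=
    finite_inter_latticePoints
      ((isBounded_convexHull.2 V.finite_toSet.isBounded).smul₀ _)
  -- All counts run over the lattice points of the full dilate, so the relation can be summed point
  -- by point.
  have hcount : ∀ S : Finset (Fin N),
      (latticeCount (convexHull ℝ (v '' (Sᶜ : Finset (Fin N)))) t : ℤ) =
        ∑ z ∈ hfin.toFinset,
          if (t : ℝ)⁻¹ • z ∈ convexHull ℝ (v '' (Sᶜ : Finset (Fin N))) then 1 else 0 := by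
    intro S
    rw [Finset.sum_boole, latticeCount, ← Set.ncard_coe_finset]
    congr 2
    ext z
    simp only [Set.mem_inter_iff, Finset.coe_filter, Set.Finite.mem_toFinset, Set.mem_ofPred_eq,
      Set.mem_smul_set_iff_inv_smul_mem₀ ht']
    constructor
    · rintro ⟨h1, h2⟩
      refine ⟨⟨convexHull_mono ?_ h1, h2⟩, h1⟩
      rw [← hrange]
      exact Set.image_subset_range _ _
    · rintro ⟨⟨-, h2⟩, h1⟩
      exact ⟨h1, h2⟩
  have hzero : ∑ S ∈ P, (-1 : ℤ) ^ S.card *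
      (latticeCount (convexHull ℝ (v '' (Sᶜ : Finset (Fin N)))) t : ℤ) = 0 := by
    simp only [hcount, Finset.mul_sum]
    rw [Finset.sum_comm]
    refine Finset.sum_eq_zero fun z _ => ?_
    refine Eq.trans ?_
      (sum_powerset_neg_one_pow_convexHull_eq_zero v lam hlam0 hlamv hpos ((t : ℝ)⁻¹ • z))
    refine Finset.sum_congr rfl fun S _ => ?_
    simp only [mem_convexHull_image_compl_iff, mul_ite, mul_one, mul_zero]
  rw [← Finset.add_sum_erase P _ (Finset.empty_mem_powerset _)] at hzero
  simp only [Finset.card_empty, pow_zero, one_mul, Finset.compl_empty, Finset.coe_univ,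
    Set.image_univ, hrange] at hzero
  rw [Polynomial.eval_neg, Polynomial.eval_finsetSum]
  have hq := congrArg (Int.cast : ℤ → ℚ) hzero
  push_cast at hq
  rw [eq_comm, ← add_eq_zero_iff_eq_neg, ← hq]
  congr 1
  refine Finset.sum_congr rfl fun S hS => ?_
  rw [Polynomial.eval_mul, hp S (Finset.nonempty_iff_ne_empty.2 (Finset.ne_of_mem_erase hS)) t ht]
  simp

/-! ### The lifting map, unimodular equivalence and lattice counts -/

variable {n : ℕ}

theorem rk_eq_ncard_of_indep (M : Matroid (Fin n)) {I : Set (Fin n)} (hI : M.Indep I) :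
    rk M I = I.ncard := by
  rw [rk, hI.eRk_eq_encard, Set.ncard]

theorem sum_indicatorVec (A : Set (Fin n)) : ∑ i, indicatorVec A i = A.ncard := by
  classical
  rw [Set.ncard_eq_toFinset_card']
  simp only [indicatorVec, Set.indicator_apply, Finset.sum_boole]
  congr 2
  ext i
  simp

theorem indicatorVec_insert {A : Set (Fin n)} {e : Fin n} (he : e ∉ A) :
    indicatorVec (insert e A) = indicatorVec A + Pi.single e 1 := by
  classical
  ext i
  rcases eq_or_ne i e with rfl | h
  · simp [indicatorVec, he]
  · simp [indicatorVec, Set.indicator_apply, h]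

theorem indicatorVec_mem_latticePoints (A : Set (Fin n)) : indicatorVec A ∈ latticePoints n := by
  classical
  refine ⟨fun i => if i ∈ A then 1 else 0, fun i => ?_⟩
  simp [indicatorVec, Set.indicator_apply]

/-- The affine map `x ↦ (x, k - ∑ x_i)`. -/
def lift (n : ℕ) (k : ℝ) : (Fin n → ℝ) →ᵃ[ℝ] (Fin (n + 1) → ℝ) where
  toFun x := Fin.snoc (α := fun _ => ℝ) x (k - ∑ i, x i)
  linear :=
    { toFun := fun x => Fin.snoc (α := fun _ => ℝ) x (-∑ i, x i)
      map_add' := fun x y => by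
        ext i
        refine Fin.lastCases ?_ (fun i => ?_) i
        · simp [Finset.sum_add_distrib, add_comm]
        · simp
      map_smul' := fun c x => by
        ext i
        refine Fin.lastCases ?_ (fun i => ?_) i
        · simp [Finset.mul_sum]
        · simp }
  map_vadd' := fun x y => by
    ext i
    refine Fin.lastCases ?_ (fun i => ?_) i
    · simp [Finset.sum_add_distrib]
      ring
    · simp

theorem lift_apply (k : ℝ) (x : Fin n → ℝ) :
    lift n k x = Fin.snoc (α := fun _ => ℝ) x (k - ∑ i, x i) := rfl

theorem lift_injective (k : ℝ) : Function.Injective (lift n k) := by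
  intro x y h
  ext i
  have := congrFun h i.castSucc
  simpa [lift_apply] using this

theorem lift_mem_latticePoints_iff (k : ℕ) (x : Fin n → ℝ) :
    lift n k x ∈ latticePoints (n + 1) ↔ x ∈ latticePoints n := by
  constructor
  · rintro ⟨z, hz⟩
    exact ⟨fun i => z i.castSucc, fun i => by simpa [lift_apply] using hz i.castSucc⟩
  · rintro ⟨z, hz⟩
    refine ⟨Fin.snoc (α := fun _ => ℤ) z (k - ∑ i, z i), fun i => ?_⟩
    refine Fin.lastCases ?_ (fun i => ?_) i
    · simp [lift_apply, hz]
    · simp [lift_apply, hz]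

/-- The map is affine, not linear, so dilation rescales its constant; for natural `t` and `k` the
new constant is still an integer. -/
theorem smul_lift (k t : ℝ) (x : Fin n → ℝ) : t • lift n k x = lift n (t * k) (t • x) := by
  ext i
  refine Fin.lastCases ?_ (fun i => ?_) i
  · simp [lift_apply, mul_sub, Finset.mul_sum]
  · simp [lift_apply]

theorem lift_indicatorVec (M : Matroid (Fin n)) {I : Set (Fin n)} (hI : M.Indep I) :
    lift n (rank M : ℕ) (indicatorVec I) =
      Fin.snoc (α := fun _ => ℝ) (indicatorVec I) ((rank M : ℝ) - (rk M I : ℝ)) := by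
  rw [lift_apply, sum_indicatorVec, rk_eq_ncard_of_indep M hI]

/-- The vertices of the lifted independence polytope are the lifts of those of the independence
polytope. -/
theorem liftedIndepPolytope_eq (M : Matroid (Fin n)) :
    liftedIndepPolytope M =
      convexHull ℝ {x | ∃ I : Set (Fin n), M.Indep I ∧ x = lift n (rank M : ℕ) (indicatorVec I)} := by
  rw [liftedIndepPolytope]
  congr 1
  ext x
  constructor
  · rintro ⟨I, hI, rfl⟩
    exact ⟨I, hI, (lift_indicatorVec M hI).symm⟩
  · rintro ⟨I, hI, rfl⟩
    exact ⟨I, hI, lift_indicatorVec M hI⟩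

theorem lift_image_indepPolytope (M : Matroid (Fin n)) :
    lift n (rank M : ℕ) '' indepPolytope M = liftedIndepPolytope M := by
  rw [liftedIndepPolytope_eq, indepPolytope, AffineMap.image_convexHull]
  congr 1
  ext x
  constructor
  · rintro ⟨_, ⟨I, hI, rfl⟩, rfl⟩
    exact ⟨I, hI, rfl⟩
  · rintro ⟨I, hI, rfl⟩
    exact ⟨_, ⟨I, hI, rfl⟩, rfl⟩

theorem unimodularlyEquivalent_indepPolytope (M : Matroid (Fin n)) :
    UnimodularlyEquivalent (indepPolytope M) (liftedIndepPolytope M) := by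
  refine ⟨lift n (rank M : ℕ), ⟨?_, (lift_injective _).injOn, ?_⟩, ?_⟩
  · intro x hx
    rw [← lift_image_indepPolytope]
    exact Set.mem_image_of_mem _ hx
  · rw [← lift_image_indepPolytope]
    exact Set.surjOn_image _ _
  · rw [← lift_image_indepPolytope, ← AffineSubspace.map_span, AffineSubspace.coe_map]
    refine ⟨fun x hx => ⟨(lift_mem_latticePoints_iff _ x).2 hx.1, Set.mem_image_of_mem _ hx.2⟩,
      (lift_injective _).injOn, ?_⟩
    rintro _ ⟨hx, x, hx', rfl⟩
    exact ⟨x, ⟨(lift_mem_latticePoints_iff _ x).1 hx, hx'⟩, rfl⟩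

theorem latticeCount_liftedIndepPolytope (M : Matroid (Fin n)) (t : ℕ) :
    latticeCount (liftedIndepPolytope M) t = latticeCount (indepPolytope M) t := by
  have hcast : (t : ℝ) * (rank M : ℕ) = ((t * rank M : ℕ) : ℝ) := by push_cast; ring
  have : ((t : ℝ) • liftedIndepPolytope M) ∩ latticePoints (n + 1) =
      lift n (t * rank M : ℕ) '' (((t : ℝ) • indepPolytope M) ∩ latticePoints n) := by
    rw [← lift_image_indepPolytope]
    ext x
    constructor
    · rintro ⟨⟨_, ⟨x, hx, rfl⟩, rfl⟩, hl⟩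
      simp only [smul_lift, hcast] at hl ⊢
      exact ⟨_, ⟨Set.smul_mem_smul_set hx, (lift_mem_latticePoints_iff _ _).1 hl⟩, rfl⟩
    · rintro ⟨_, ⟨⟨x, hx, rfl⟩, hl⟩, rfl⟩
      refine ⟨⟨_, ⟨x, hx, rfl⟩, ?_⟩, (lift_mem_latticePoints_iff _ _).2 hl⟩
      simp only [smul_lift, hcast]
  rw [latticeCount, this, (lift_injective _).injOn.ncard_image, latticeCount]

theorem exists_isEhrhartPolynomial_indepPolytope (M : Matroid (Fin n)) :
    ∃ p, IsEhrhartPolynomial (indepPolytope M) p ∧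
      IsEhrhartPolynomial (liftedIndepPolytope M) p := by
  have hfin : {x | ∃ I : Set (Fin n), M.Indep I ∧ x = indicatorVec I}.Finite :=
    (Set.finite_range indicatorVec).subset (by rintro _ ⟨I, -, rfl⟩; exact ⟨I, rfl⟩)
  obtain ⟨p, hp⟩ := exists_isEhrhartPolynomial hfin.toFinset (by
    intro x hx
    obtain ⟨I, -, rfl⟩ := hfin.mem_toFinset.1 hx
    exact indicatorVec_mem_latticePoints I)
  rw [hfin.coe_toFinset] at hp
  refine ⟨p, hp, fun t ht => ?_⟩
  rw [latticeCount_liftedIndepPolytope]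
  exact hp t ht

/-! ### Matroid exchange and the edges of the lifted polytope -/

/-- Two independent sets of maximal weight that differ give rise to two independent sets of
maximal weight related by adding an element or by exchanging an element. -/
theorem exists_maximal_indep_exchange (M : Matroid (Fin n)) (hE : M.E = Set.univ)
    (w : Fin n → ℝ) (W : Set (Fin n) → ℝ)
    (hW : ∀ A : Set (Fin n), ∀ e ∉ A, W (insert e A) = W A + w e)
    {I J : Set (Fin n)} (hI : M.Indep I) (hJ : M.Indep J) (hIJ : I ≠ J)
    (hImax : ∀ A, M.Indep A → W A ≤ W I) (hJmax : ∀ A, M.Indep A → W A ≤ W J) :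
    ∃ A e, e ∉ A ∧ M.Indep (insert e A) ∧ W (insert e A) = W I ∧
      ((M.Indep A ∧ W A = W I) ∨
        ∃ f, f ∉ A ∧ f ≠ e ∧ M.Indep (insert f A) ∧ W (insert f A) = W I) := by
  classical
  have hWIJ : W I = W J := le_antisymm (hJmax I hI) (hImax J hJ)
  have hne : ((symmDiff I J).toFinset).Nonempty := by
    rw [Set.toFinset_nonempty, Set.nonempty_iff_ne_empty]
    exact fun h => hIJ (symmDiff_eq_bot.1 h)
  -- Taking `e` heaviest in the symmetric difference ensures that exchanging it for an `f` on the
  -- other side cannot lower the weight.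
  obtain ⟨e, he, hmax⟩ := Finset.exists_max_image _ w hne
  simp only [Set.mem_toFinset] at he hmax
  wlog heI : e ∈ I ∧ e ∉ J generalizing I J
  · rw [hWIJ]
    refine this hJ hI hIJ.symm hJmax hImax hWIJ.symm (by rwa [symmDiff_comm])
      (by rwa [symmDiff_comm]) (by rwa [symmDiff_comm]) ?_
    exact (Set.mem_symmDiff.1 he).resolve_left heI
  obtain ⟨heI, heJ⟩ := heI
  -- If `e` can be added to `J`, maximality of `J` gives `w e ≤ 0`, while removing `e` from `I`
  -- gives `0 ≤ w e`; so `w e = 0`.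
  by_cases hins : M.Indep (insert e J)
  · have h1 := hW J e heJ
    have h2 := hJmax _ hins
    have h3 := hW (I \ {e}) e (by simp)
    rw [Set.insert_sdiff_singleton, Set.insert_eq_of_mem heI] at h3
    have h4 := hImax _ (hI.subset (Set.sdiff_subset (t := {e})))
    exact ⟨J, e, heJ, hins, by linarith, Or.inl ⟨hJ, hWIJ.symm⟩⟩
  have hecl : e ∈ M.closure J := by
    by_contra h
    exact hins ((hJ.insert_indep_iff_of_notMem heJ).2 ⟨hE ▸ Set.mem_univ e, h⟩)
  have hC := hJ.fundCircuit_isCircuit hecl heJ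
  -- The fundamental circuit of `e` in `J` is dependent, so it is not contained in `I` and has an
  -- element `f` of `J \ I`. Then `w f ≤ w e`, and maximality of `J` makes the exchange
  -- weight-preserving.
  obtain ⟨f, hfC, hfI⟩ := Set.not_subset.1 fun h => hC.not_indep (hI.subset h)
  have hfe : f ≠ e := fun h => hfI (h ▸ heI)
  have hfJ : f ∈ J := ((M.fundCircuit_subset_insert e J) hfC).resolve_left hfe
  have hind := (hJ.mem_fundCircuit_iff hecl heJ).1 hfC
  have hset : insert e J \ {f} = insert e (J \ {f}) :=
    Set.insert_sdiff_singleton_comm hfe.symm J |>.symm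
  rw [hset] at hind
  have hJf : insert f (J \ {f}) = J := by
    rw [Set.insert_sdiff_singleton, Set.insert_eq_of_mem hfJ]
  have h1 := hW (J \ {f}) e (fun h => heJ h.1)
  have h2 := hW (J \ {f}) f (by simp)
  rw [hJf] at h2
  have h3 := hmax f (Or.inr ⟨hfJ, hfI⟩)
  have h4 := hJmax _ hind
  exact ⟨J \ {f}, e, fun h => heJ h.1, hind, by linarith,
    Or.inr ⟨f, by simp, hfe, hJf.symm ▸ hJ, by rw [hJf, hWIJ]⟩⟩

theorem lift_sub_lift (k : ℝ) (x y : Fin n → ℝ) :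
    lift n k x - lift n k y = Fin.snoc (α := fun _ => ℝ) (x - y) (-∑ i, (x - y) i) := by
  ext i
  refine Fin.lastCases ?_ (fun i => ?_) i
  · simp [lift_apply]
  · simp [lift_apply]

theorem isGeneralizedPermutohedron_liftedIndepPolytope (M : Matroid (Fin n))
    (hE : M.E = Set.univ) : IsGeneralizedPermutohedron (liftedIndepPolytope M) := by
  set k : ℕ := rank M
  set V : Set (Fin (n + 1) → ℝ) :=
    {x | ∃ I : Set (Fin n), M.Indep I ∧ x = lift n k (indicatorVec I)} with hV
  have hPV : liftedIndepPolytope M = convexHull ℝ V := liftedIndepPolytope_eq M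
  have hVfin : V.Finite := (Set.finite_range fun I : Set (Fin n) => lift n k (indicatorVec I)).subset
    (by rintro _ ⟨I, -, rfl⟩; exact ⟨I, rfl⟩)
  refine ⟨⟨V, hVfin, hPV⟩, ?_⟩
  rintro F ⟨hFne, hFexp, hFdim⟩
  obtain ⟨l, hl⟩ := hFexp hFne
  have hVP : ∀ I, M.Indep I → lift n k (indicatorVec I) ∈ liftedIndepPolytope M := fun I hI =>
    hPV ▸ subset_convexHull ℝ V ⟨I, hI, rfl⟩
  obtain ⟨x₀, hx₀⟩ := hFne
  rw [hl] at hx₀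
  obtain ⟨hx₀P, hx₀max⟩ := hx₀
  -- A maximizer written as a convex combination of vertices puts weight only on vertices that are
  -- maximizers: the terms `c y * (l x - l y)` are nonnegative with sum zero.
  have hFV : F ⊆ convexHull ℝ (F ∩ V) := by
    intro x hx
    rw [hl] at hx
    obtain ⟨hxP, hxmax⟩ := hx
    rw [hPV, ← hVfin.coe_toFinset, Finset.mem_convexHull'] at hxP
    obtain ⟨c, hc0, hc1, hcx⟩ := hxP
    have hlx : ∑ y ∈ hVfin.toFinset, c y * (l x - l y) = 0 := by
      simp only [mul_sub, Finset.sum_sub_distrib, ← Finset.sum_mul, hc1, one_mul]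
      rw [sub_eq_zero]
      conv_lhs => rw [← hcx]
      simp [map_sum]
    have hterm := (Finset.sum_eq_zero_iff_of_nonneg fun y hy =>
      mul_nonneg (hc0 y hy) (sub_nonneg.2 (hxmax y
        (hPV ▸ subset_convexHull ℝ V (hVfin.mem_toFinset.1 hy))))).1 hlx
    have hsub : ∑ y ∈ hVfin.toFinset, c y • y =
        ∑ y ∈ hVfin.toFinset.filter (fun y => c y ≠ 0), c y • y := by
      rw [Finset.sum_filter]
      refine Finset.sum_congr rfl fun y _ => ?_
      by_cases h : c y = 0 <;> simp [h]
    rw [← hcx, hsub]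
    refine (convex_convexHull ℝ _).sum_mem (fun y hy => hc0 y (Finset.mem_filter.1 hy).1) ?_ ?_
    · rw [← hc1, Finset.sum_filter_ne_zero]
    · intro y hy
      obtain ⟨hy, hcy⟩ := Finset.mem_filter.1 hy
      have hyV := hVfin.mem_toFinset.1 hy
      refine subset_convexHull ℝ _ ⟨?_, hyV⟩
      rw [hl]
      refine ⟨hPV ▸ subset_convexHull ℝ V hyV, fun z hz => ?_⟩
      have := (mul_eq_zero.1 (hterm y hy)).resolve_left hcy
      linarith [hxmax z hz]
  have hmemF : ∀ I, M.Indep I → (lift n k (indicatorVec I) ∈ F ↔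
      ∀ A, M.Indep A → l (lift n k (indicatorVec A)) ≤ l (lift n k (indicatorVec I))) := by
    intro I hI
    rw [hl]
    constructor
    · exact fun h A hA => h.2 _ (hVP A hA)
    · intro h
      refine ⟨hVP I hI, fun y hy => ?_⟩
      rw [hPV] at hy
      have hconv : Convex ℝ {y | l y ≤ l (lift n k (indicatorVec I))} :=
        convex_halfSpace_le l.toLinearMap.isLinear _
      refine convexHull_min ?_ hconv hy
      rintro _ ⟨A, hA, rfl⟩
      exact h A hA
  have hnontriv : ¬ (F ∩ V).Subsingleton := by
    intro hsub
    have hF : F.Subsingleton := by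
      rcases hsub.eq_empty_or_singleton with h | ⟨y, h⟩
      · rw [h, convexHull_empty] at hFV
        exact Set.subsingleton_empty.anti hFV
      · rw [h, convexHull_singleton] at hFV
        exact Set.subsingleton_singleton.anti hFV
    rw [vectorSpan_of_subsingleton ℝ hF, finrank_bot] at hFdim
    exact zero_ne_one hFdim
  rw [Set.not_subsingleton_iff] at hnontriv
  obtain ⟨_, ⟨hxF, I, hI, rfl⟩, _, ⟨hyF, J, hJ, rfl⟩, hxy⟩ := hnontriv
  have hIJ : I ≠ J := fun h => hxy (h ▸ rfl)
  -- Adding `e` to a set moves its lift by e_e - e_{n+1}, so `w e` is the resulting change of the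
  -- functional.
  let w : Fin n → ℝ := fun e => l (Fin.snoc (α := fun _ => ℝ) (Pi.single e 1) (-1))
  have hinsert : ∀ A : Set (Fin n), ∀ e ∉ A, lift n k (indicatorVec (insert e A)) =
      lift n k (indicatorVec A) + Fin.snoc (α := fun _ => ℝ) (Pi.single e 1) (-1) := by
    intro A e he
    rw [← sub_eq_iff_eq_add', lift_sub_lift, indicatorVec_insert he, add_sub_cancel_left]
    simp
  obtain ⟨A, e, heA, hAe, hWe, hcase⟩ := exists_maximal_indep_exchange M hE w
    (fun A => l (lift n k (indicatorVec A))) (fun A e he => by rw [hinsert A e he, map_add])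
    hI hJ hIJ ((hmemF I hI).1 hxF) ((hmemF J hJ).1 hyF)
  have hmem : ∀ B, M.Indep B → l (lift n k (indicatorVec B)) = l (lift n k (indicatorVec I)) →
      lift n k (indicatorVec B) ∈ F := fun B hB h =>
    (hmemF B hB).2 (h ▸ (hmemF I hI).1 hxF)
  -- The edge has a one-dimensional direction space, so any nonzero vector in it spans it.
  have hspan : ∀ i j : Fin (n + 1), i ≠ j →
      (Pi.single i 1 - Pi.single j 1 : Fin (n + 1) → ℝ) ∈ vectorSpan ℝ F →
      vectorSpan ℝ F = Submodule.span ℝ {(Pi.single i 1 - Pi.single j 1 : Fin (n + 1) → ℝ)} := by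
    intro i j hij h
    have hne : (Pi.single i 1 - Pi.single j 1 : Fin (n + 1) → ℝ) ≠ 0 := by
      intro h0
      have := congrFun h0 i
      simp [hij] at this
    refine (Submodule.eq_of_le_of_finrank_eq (Submodule.span_le.2 (by simpa using h)) ?_).symm
    rw [finrank_span_singleton hne, hFdim]
  have hsnoc : ∀ e : Fin n, (Fin.snoc (α := fun _ => ℝ) (Pi.single e 1) (-1) : Fin (n + 1) → ℝ) =
      Pi.single e.castSucc 1 - Pi.single (Fin.last n) 1 := by
    intro e
    ext i
    refine Fin.lastCases ?_ (fun i => ?_) i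
    · simp [(Fin.castSucc_ne_last _).symm]
    · simp [Pi.single_apply, Fin.castSucc_ne_last]
  rcases hcase with ⟨hA, hWA⟩ | ⟨f, hfA, hfe, hAf, hWf⟩
  · refine ⟨e.castSucc, Fin.last n, Fin.castSucc_ne_last e, hspan _ _ (Fin.castSucc_ne_last e) ?_⟩
    have := vsub_mem_vectorSpan ℝ (hmem _ hAe hWe) (hmem _ hA hWA)
    rwa [hinsert A e heA, vsub_eq_sub, add_sub_cancel_left, hsnoc] at this
  · have hne : e.castSucc ≠ f.castSucc := fun h => hfe (Fin.castSucc_injective n h).symm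
    refine ⟨e.castSucc, f.castSucc, hne, hspan _ _ hne ?_⟩
    have := vsub_mem_vectorSpan ℝ (hmem _ hAe hWe) (hmem _ hAf hWf)
    rwa [hinsert A e heA, hinsert A f hfA, vsub_eq_sub, add_sub_add_left_eq_sub, hsnoc, hsnoc,
      sub_sub_sub_cancel_right] at this

end LiftedIndependence

theorem mainTheorem3 (n : ℕ) (M : Matroid (Fin n)) (hE : M.E = Set.univ) :
    LiftedIndependence.IsGeneralizedPermutohedron (LiftedIndependence.liftedIndepPolytope M) ∧
    LiftedIndependence.UnimodularlyEquivalent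
      (LiftedIndependence.indepPolytope M) (LiftedIndependence.liftedIndepPolytope M) ∧
    ∃ p : Polynomial ℚ,
      LiftedIndependence.IsEhrhartPolynomial (LiftedIndependence.indepPolytope M) p ∧
      LiftedIndependence.IsEhrhartPolynomial (LiftedIndependence.liftedIndepPolytope M) p :=
  ⟨LiftedIndependence.isGeneralizedPermutohedron_liftedIndepPolytope M hE,
    LiftedIndependence.unimodularlyEquivalent_indepPolytope M,
    LiftedIndependence.exists_isEhrhartPolynomial_indepPolytope M⟩
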